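/- **Setting.** Let $m\ge 2$, $n\ge 2$ and $d_1,\dots,d_m\ge 1$ be integers, and let $m$ players $A_1,\dots,A_m$ share the space $\mathcal H=\bigotimes_{k=1}^m\mathbb C^{d_k}$. Let $\mathcal E=\{\eta_i,\rho_i\}_{i=0}^{n-1}$ be an ensemble of density operators on $\mathcal H$, where $\eta_i\ge 0$ and $\sum_i\eta_i=1$. A measurement is a family $\{M_i\}_{i=0}^{n-1}$ of positive semidefinite operators with $\sum_iM_i=\mathbb 1$. For a partition $\mathsf X$ of the set of players, an $\mathsf X$-LOCC measurement is one that can be realized by finitely many rounds of local measurements on the blocks of $\mathsf X$ and classical communication among the blocks. Put $$p_{\mathsf G}(\mathcal E)=\max_{M}\sum_i\eta_i\operatorname{Tr}(\rho_iM_i),\qquad p_{\mathsf X}(\mathcal E)=\sup_{M\ \mathsf X\text{-LOCC}}\sum_i\eta_i\operatorname{Tr}(\rho_iM_i),\qquad q_{\mathsf X}(\mathcal E)=\max_{M}\sum_i\eta_i\operatorname{Tr}(\Gamma_{\mathsf X}(\rho_i)M_i),$$ where both maxima are over all measurements and, in the last formula, $\mathsf X$ is a bipartition (a partition into two blocks)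 and $\Gamma_{\mathsf X}$ is the partial transposition with respect to it. For $L\ge1$ and $\vec c\in\{0,\dots,n-1\}^L$ let $\eta_{\vec c}=\prod_l\eta_{c_l}$, $\rho_{\vec c}=\bigotimes_l\rho_{c_l}$ (each player holds the $L$ copies of its system) and $\omega_n(\vec c)=\sum_lc_l \bmod n$. Let $\mathcal E^{(L)}=\{\eta^{(L)}_i,\rho^{(L)}_i\}_{i=0}^{n-1}$ with $$\eta^{(L)}_i=\sum_{\omega_n(\vec c)=i}\eta_{\vec c},\qquad \rho^{(L)}_i=\frac1{\eta_i^{(L)}}\sum_{\omega_n(\vec c)=i}\eta_{\vec c}\,\rho_{\vec c}$$ (if $\eta_i^{(L)}=0$, the choice of $\rho_i^{(L)}$ is immaterial). **The scheme.** To hide $x\in\{0,\dots,n-1\}$, a hider draws $\vec c$ with probability $\eta_{\vec c}$, sends $\rho_{\vec c}$ to the players and broadcasts $z=x+\omega_n(\vec c)\bmod n$. The players guess $x$ from $z$ and the outcome of a measurement on $\rho_{\vec c}$, which may be chosen depending on $z$. **Theorem.** Suppose that $p_{\mathsf G}(\mathcal E)=1$ and $Q:=\max_{\mathsf X}q_{\mathsf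 X}(\mathcal E)<\frac2n$, the maximum being over all bipartitions $\mathsf X$ of the players. Then $\mathcal E$ yields an $m$-player scheme hiding $n$-ary data: 1. $p_{\mathsf G}(\mathcal E^{(L)})=1$ for all $L\ge1$. 2. For every nontrivial partition $\mathsf X$ (at least two blocks), $p_{\mathsf X}(\mathcal E^{(L)})\to\frac1n$ as $L\to\infty$. 3. The convergence is exponentially fast: $0\le nQ-1<1$, and for every nontrivial partition $\mathsf X$ and every $L\ge 1$, $$\frac1n\le p_{\mathsf X}(\mathcal E^{(L)})\le\frac1n+\frac{n-1}n\,(nQ-1)^L .$$ 4. For every $L\ge1$ there are global measurements, one for each $z$, with which the players recover every $x$ with probability $1$. 5. For every $L\ge1$ and uniformly distributed $x$, the optimal average probability of guessing $x$ in the scheme is $p_{\mathsf G}(\mathcal E^{(L)})$ if all measurements are allowed, and $p_{\mathsf X}(\mathcal E^{(L)})$ if only $\mathsf X$-LOCC measurements are allowed, for every partition $\mathsf X$. -/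

import Mathlib

open Filter Topology
open scoped Matrix ComplexOrder

noncomputable section

namespace DataHiding

/-! ### Measurements and ensembles

A system with orthonormal basis indexed by a finite type `I` has the operators `Matrix I I ℂ`.
If `m` players hold systems with bases `ι k`, `k : Fin m`, the basis of the joint system
`⨂ k, ℂ^(ι k)` is `∀ k, ι k`. -/

/-- A measurement (POVM) with outcomes `0, …, n - 1`. -/
def IsMeasurement {n : ℕ} {I : Type} [Fintype I] [DecidableEq I]
    (M : Fin n → Matrix I I ℂ) : Prop :=
  (∀ i, (M i).PosSemidef) ∧ ∑ i, M i = 1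

/-- The set of all global measurements. -/
def globalMeasurements (n : ℕ) (I : Type) [Fintype I] [DecidableEq I] :
    Set (Fin n → Matrix I I ℂ) :=
  {M | IsMeasurement M}

/-- A family of `n` weights and `n` operators; see `Ensemble.IsStateEnsemble`. -/
structure Ensemble (n : ℕ) (I : Type) where
  /-- The probability of the `i`-th state. -/
  prob : Fin n → ℝ
  /-- The `i`-th state. -/
  state : Fin n → Matrix I I ℂ

/-- The weights are a probability vector and the operators are density operators. -/
structure Ensemble.IsStateEnsemble {n : ℕ} {I : Type} [Fintype I] (E : Ensemble n I) : Prop where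
  prob_nonneg : ∀ i, 0 ≤ E.prob i
  prob_sum : ∑ i, E.prob i = 1
  state_posSemidef : ∀ i, (E.state i).PosSemidef
  state_trace : ∀ i, (E.state i).trace = 1

/-- `∑ i, η i * Tr (ρ i * M i)`. -/
def Ensemble.successProb {n : ℕ} {I : Type} [Fintype I] (E : Ensemble n I)
    (M : Fin n → Matrix I I ℂ) : ℝ :=
  ∑ i, E.prob i * (E.state i * M i).trace.re

/-- The optimal success probability in discriminating the states of `E` with the measurements
in the class `C`. -/
def Ensemble.optSuccess {n : ℕ} {I : Type} [Fintype I] (E : Ensemble n I)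
    (C : Set (Fin n → Matrix I I ℂ)) : ℝ :=
  sSup (E.successProb '' C)

/-! ### Measurements by local operations and classical communication -/

/-- The tensor product, over the parties `p`, of the local operators `K p`. -/
def tensorOp {P : Type} [Fintype P] {κ κ' : P → Type} (K : ∀ p, Matrix (κ' p) (κ p) ℂ) :
    Matrix (∀ p, κ' p) (∀ p, κ p) ℂ :=
  fun x y => ∏ p, K p (x p) (y p)

/-- `IsLOCCRounds r κ M`: the measurement `M` on the parties `P`, whose systems have the bases
`κ p`, can be realized with `r` rounds of local measurements and classical communication.
With no round left the parties announce a guess. In a round, each party `p` performs a local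
measurement with finitely many outcomes `j`, given by Kraus operators `K p j` from its present
system to a system of any finite dimension `d p j` (so that ancillas may be attached and systems
discarded) and tells its outcome to all the others; the rest of the protocol may depend on all
the outcomes. A party that does nothing in a round uses a single unitary Kraus operator. -/
def IsLOCCRounds {P : Type} [Fintype P] [DecidableEq P] {n : ℕ} :
    (r : ℕ) → (κ : P → Type) → [∀ p, Fintype (κ p)] → [∀ p, DecidableEq (κ p)] →
      (Fin n → Matrix (∀ p, κ p) (∀ p, κ p) ℂ) → Prop
  | 0, _, _, _, M => ∃ g : Fin n, ∀ i, M i = if i = g then 1 else 0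
  | r + 1, κ, _, _, M =>
      ∃ (a : P → ℕ) (d : ∀ p, Fin (a p) → ℕ) (K : ∀ p (j : Fin (a p)), Matrix (Fin (d p j)) (κ p) ℂ)
        (N : ∀ j : (∀ p, Fin (a p)),
          Fin n → Matrix (∀ p, Fin (d p (j p))) (∀ p, Fin (d p (j p))) ℂ),
        (∀ p, ∑ j, (K p j)ᴴ * K p j = 1) ∧
        (∀ j, IsLOCCRounds r (fun p => Fin (d p (j p))) (N j)) ∧
        ∀ i, M i = ∑ j : (∀ p, Fin (a p)),
          (tensorOp fun p => K p (j p))ᴴ * N j i * tensorOp fun p => K p (j p)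

/-- Regroup a basis index of the joint system of the `m` players according to the partition `X`:
the party `A ∈ X` holds the systems of all the players in `A`. -/
def regroup {m : ℕ} {ι : Fin m → Type} (X : Finpartition (Finset.univ : Finset (Fin m)))
    (x : ∀ k, ι k) : ∀ A : {A // A ∈ X.parts}, ∀ k : {k // k ∈ A.1}, ι k.1 :=
  fun _ k => x k.1

/-- The `X`-LOCC measurements: those realized by LOCC among the blocks of the partition `X`. -/
def loccMeasurements (n : ℕ) {m : ℕ} (ι : Fin m → Type)
    [∀ k, Fintype (ι k)] [∀ k, DecidableEq (ι k)]
    (X : Finpartition (Finset.univ : Finset (Fin m))) :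
    Set (Fin n → Matrix (∀ k, ι k) (∀ k, ι k) ℂ) :=
  {M | ∃ (r : ℕ) (N : Fin n → Matrix
        (∀ A : {A // A ∈ X.parts}, ∀ k : {k // k ∈ A.1}, ι k.1)
        (∀ A : {A // A ∈ X.parts}, ∀ k : {k // k ∈ A.1}, ι k.1) ℂ),
      IsLOCCRounds r (fun A : {A // A ∈ X.parts} => ∀ k : {k // k ∈ A.1}, ι k.1) N ∧
      ∀ i, M i = (N i).submatrix (regroup X) (regroup X)}

/-- `p_G(E)`: the optimal success probability over all measurements. -/
def Ensemble.pG {n : ℕ} {I : Type} [Fintype I] [DecidableEq I] (E : Ensemble n I) : ℝ :=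
  E.optSuccess (globalMeasurements n I)

/-- `p_X(E)`: the optimal success probability over the `X`-LOCC measurements. -/
def Ensemble.pX {n m : ℕ} {ι : Fin m → Type} [∀ k, Fintype (ι k)] [∀ k, DecidableEq (ι k)]
    (X : Finpartition (Finset.univ : Finset (Fin m))) (E : Ensemble n (∀ k, ι k)) : ℝ :=
  E.optSuccess (loccMeasurements n ι X)

/-! ### Partial transposition -/

/-- Transposition of the systems of the players in `S`. -/
def partialTranspose {m : ℕ} {ι : Fin m → Type} (S : Finset (Fin m))
    (ρ : Matrix (∀ k, ι k) (∀ k, ι k) ℂ) : Matrix (∀ k, ι k) (∀ k, ι k) ℂ :=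
  fun x y => ρ (S.piecewise y x) (S.piecewise x y)

/-- `Γ_X(ρ)` for a bipartition `X = {A, B}`, where `A` is the block of the first player: the
transposition of the systems in `B`. (Transposing those in `A` instead would change `Γ_X(ρ)` by
a full transposition, which does not affect `qX` below.) -/
def bipartiteTranspose {m : ℕ} [NeZero m] {ι : Fin m → Type}
    (X : Finpartition (Finset.univ : Finset (Fin m)))
    (ρ : Matrix (∀ k, ι k) (∀ k, ι k) ℂ) : Matrix (∀ k, ι k) (∀ k, ι k) ℂ :=
  partialTranspose (X.part 0)ᶜ ρ

/-- `q_X(E)`: the maximum of `∑ i, η i * Tr (Γ_X (ρ i) * M i)` over all measurements. -/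
def Ensemble.qX {n m : ℕ} [NeZero m] {ι : Fin m → Type}
    [∀ k, Fintype (ι k)] [∀ k, DecidableEq (ι k)]
    (X : Finpartition (Finset.univ : Finset (Fin m))) (E : Ensemble n (∀ k, ι k)) : ℝ :=
  Ensemble.pG ⟨E.prob, fun i => bipartiteTranspose X (E.state i)⟩

/-- The maximum of `q_X(E)` over the bipartitions `X` of the set of players. -/
def Ensemble.qMax {n m : ℕ} [NeZero m] {ι : Fin m → Type}
    [∀ k, Fintype (ι k)] [∀ k, DecidableEq (ι k)] (E : Ensemble n (∀ k, ι k)) : ℝ :=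
  ⨆ X : {X : Finpartition (Finset.univ : Finset (Fin m)) // X.parts.card = 2}, E.qX X.1

/-! ### Multi-fold ensembles -/

/-- `η_c = ∏ l, η_{c l}`. -/
def Ensemble.foldProb {n : ℕ} {I : Type} (E : Ensemble n I) {L : ℕ} (c : Fin L → Fin n) : ℝ :=
  ∏ l, E.prob (c l)

/-- `ρ_c = ⨂ l, ρ_{c l}`, where player `k` holds the `L` copies of its system. -/
def Ensemble.foldState {n m : ℕ} {ι : Fin m → Type} (E : Ensemble n (∀ k, ι k)) {L : ℕ}
    (c : Fin L → Fin n) : Matrix (∀ k, Fin L → ι k) (∀ k, Fin L → ι k) ℂ :=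
  fun x y => ∏ l, E.state (c l) (fun k => x k l) (fun k => y k l)

/-- `ω_n(c)`: the sum modulo `n` of the entries of `c`. -/
def modSum {n : ℕ} [NeZero n] {L : ℕ} (c : Fin L → Fin n) : Fin n :=
  Fin.ofNat n (∑ l, (c l : ℕ))

/-- The ensemble `E^(L)`. An index of probability zero gets the operator `0`; the operator
attached to such an index has no influence on success probabilities. -/
def Ensemble.multi {n m : ℕ} [NeZero n] {ι : Fin m → Type} (L : ℕ) (E : Ensemble n (∀ k, ι k)) :
    Ensemble n (∀ k, Fin L → ι k) where
  prob i := ∑ c : Fin L → Fin n with modSum c = i, E.foldProb c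
  state i := ((∑ c : Fin L → Fin n with modSum c = i, E.foldProb c : ℝ) : ℂ)⁻¹ •
    ∑ c : Fin L → Fin n with modSum c = i, (E.foldProb c : ℂ) • E.foldState c

/-! ### The data-hiding scheme

To hide `x`, the hider draws `c` with probability `η_c`, sends `ρ_c` to the players and
broadcasts `z = x + ω_n(c)` modulo `n`. The players then choose, depending on `z`, a measurement
`M z` whose outcome is their guess of `x`. -/

/-- The probability that the players using the measurements `M z` guess the hidden data `x`. -/
def Ensemble.recoverProb {n m : ℕ} [NeZero n] {ι : Fin m → Type} [∀ k, Fintype (ι k)]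
    [∀ k, DecidableEq (ι k)] (E : Ensemble n (∀ k, ι k)) (L : ℕ)
    (M : Fin n → Fin n → Matrix (∀ k, Fin L → ι k) (∀ k, Fin L → ι k) ℂ) (x : Fin n) : ℝ :=
  ∑ c : Fin L → Fin n, E.foldProb c * (E.foldState c * M (x + modSum c) x).trace.re

/-- The optimal average probability of guessing uniformly distributed hidden data with
measurements from the class `C`. -/
def Ensemble.optRecover {n m : ℕ} [NeZero n] {ι : Fin m → Type} [∀ k, Fintype (ι k)]
    [∀ k, DecidableEq (ι k)] (E : Ensemble n (∀ k, ι k)) (L : ℕ)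
    (C : Set (Fin n → Matrix (∀ k, Fin L → ι k) (∀ k, Fin L → ι k) ℂ)) : ℝ :=
  sSup {p | ∃ M : Fin n → Fin n → Matrix (∀ k, Fin L → ι k) (∀ k, Fin L → ι k) ℂ,
    (∀ z, M z ∈ C) ∧ p = (1 / (n : ℝ)) * ∑ x, E.recoverProb L M x}

end DataHiding

end

noncomputable section

namespace DataHiding

/-! ### Positive semidefinite matrices -/

/-! Of LOCC, the upper bound uses only that each element of an LOCC measurement keeps a positive
partial transpose across every block (`IsLOCCRounds.posSemidef_partyTranspose`). Partial
transposition preserves `Tr (A * B)`, so it can be moved onto the states: an `X`-LOCC strategy on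
`E^(L)` earns what some measurement earns on the operators `Γ(η_c ρ_c)`, summed over each class of
words.

Let `σ i = Γ(η i ρ i)` and let `q` be their optimal reward. Strong duality (`exists_dual_optimal`)
gives `H ≥ σ i` for all `i` with `Tr H = q`. Put `e i = H - σ i ≥ 0`; then `Tr ∑ e i = nq - 1`.
Since `σ i + e i` does not depend on `i`, the deviations of `σ` and `e` from their means over `i`
are opposite, and convolution over `ℤ/n` acts on deviations alone. Hence the `L`-fold convolutions
of `σ` and `e` deviate from their means by the same operator up to the sign `(-1)^L`
(`convProd_eq_of_add_eq`). Those of `e` lie between `0` and `T = (∑ e i)^{⊗L}`, so those of `σ` lie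
below `(1/n)(∑ σ i)^{⊗L} + (1 - 1/n) T` (`convOp_le`). This single operator is dual feasible, and
its trace is the stated bound (`reward_convOp_le`). The condition `Q < 2/n` says precisely that `nQ
- 1 < 1`.

Globally, a perfect measurement applied copy by copy, with outcomes added modulo `n`, remains
perfect (`reward_convOp_eq_one`). In the scheme, once `z` is known, guessing `x` is guessing `ω_n(c)
= z - x`, a mere relabelling of outcomes (`optRecover_eq_optSuccess`). -/

lemma exists_eq_conjTranspose_mul_self {I : Type} [Fintype I] {A : Matrix I I ℂ}
    (hA : A.PosSemidef) : ∃ B : Matrix I I ℂ, A = Bᴴ * B := by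
  classical
  open scoped MatrixOrder Matrix.Norms.L2Operator in
  exact CStarAlgebra.nonneg_iff_eq_star_mul_self.mp hA.nonneg

lemma trace_mul_nonneg {I : Type} [Fintype I] {A B : Matrix I I ℂ}
    (hA : A.PosSemidef) (hB : B.PosSemidef) : 0 ≤ (A * B).trace := by
  obtain ⟨C, rfl⟩ := exists_eq_conjTranspose_mul_self hB
  have h : (A * (Cᴴ * C)).trace = (C * A * Cᴴ).trace := by
    rw [← Matrix.mul_assoc, Matrix.trace_mul_comm, Matrix.mul_assoc]
  rw [h]
  exact (hA.mul_mul_conjTranspose_same C).trace_nonneg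

lemma posSemidef_ofReal_smul {I : Type} {A : Matrix I I ℂ} (hA : A.PosSemidef) {t : ℝ}
    (ht : 0 ≤ t) : ((t : ℂ) • A).PosSemidef :=
  hA.smul (by exact_mod_cast ht)

/-! ### Tensor products of operators -/

section tensorOp

variable {P : Type} [Fintype P] {κ κ' κ'' : P → Type}

lemma tensorOp_mul [DecidableEq P] [∀ p, Fintype (κ' p)]
    (A : ∀ p, Matrix (κ'' p) (κ' p) ℂ) (B : ∀ p, Matrix (κ' p) (κ p) ℂ) :
    tensorOp A * tensorOp B = tensorOp fun p => A p * B p := by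
  ext x y
  simp only [tensorOp, Matrix.mul_apply, Finset.prod_univ_sum, Fintype.piFinset_univ,
    Finset.prod_mul_distrib]

lemma tensorOp_conjTranspose (A : ∀ p, Matrix (κ' p) (κ p) ℂ) :
    (tensorOp A)ᴴ = tensorOp fun p => (A p)ᴴ := by
  ext x y
  simp [tensorOp, Matrix.conjTranspose_apply]

lemma tensorOp_one [DecidableEq P] [∀ p, DecidableEq (κ p)] :
    tensorOp (fun p => (1 : Matrix (κ p) (κ p) ℂ)) = 1 := by
  ext x y
  by_cases h : x = y
  · subst h; simp [tensorOp]
  · obtain ⟨p, hp⟩ := Function.ne_iff.mp h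
    rw [Matrix.one_apply_ne h]
    exact Finset.prod_eq_zero (Finset.mem_univ p) (Matrix.one_apply_ne hp)

lemma tensorOp_sum [DecidableEq P] {J : P → Type} [∀ p, Fintype (J p)]
    (A : ∀ p, J p → Matrix (κ' p) (κ p) ℂ) :
    tensorOp (fun p => ∑ j, A p j) = ∑ c : (∀ p, J p), tensorOp fun p => A p (c p) := by
  ext x y
  simp only [tensorOp, Matrix.sum_apply, Finset.prod_univ_sum, Fintype.piFinset_univ]

lemma trace_tensorOp [DecidableEq P] [∀ p, Fintype (κ p)] (A : ∀ p, Matrix (κ p) (κ p) ℂ) :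
    (tensorOp A).trace = ∏ p, (A p).trace := by
  simp only [Matrix.trace, tensorOp, Matrix.diag_apply, Finset.prod_univ_sum,
    Fintype.piFinset_univ]

lemma tensorOp_posSemidef [DecidableEq P] [∀ p, Fintype (κ p)] {A : ∀ p, Matrix (κ p) (κ p) ℂ}
    (hA : ∀ p, (A p).PosSemidef) : (tensorOp A).PosSemidef := by
  choose B hB using fun p => exists_eq_conjTranspose_mul_self (hA p)
  have h : tensorOp A = (tensorOp B)ᴴ * tensorOp B := by
    rw [tensorOp_conjTranspose, tensorOp_mul]
    exact congrArg _ (funext hB)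
  rw [h]
  exact Matrix.posSemidef_conjTranspose_mul_self _

end tensorOp

/-! ### Copies of a multipartite system -/

section copies

variable {m n : ℕ} {ι : Fin m → Type} {L : ℕ}

/-- The operator `⨂ l, A l` on `L` copies of a multipartite system, with the copies of each
player's system grouped together. -/
def copiesOp (A : Fin L → Matrix (∀ k, ι k) (∀ k, ι k) ℂ) :
    Matrix (∀ k, Fin L → ι k) (∀ k, Fin L → ι k) ℂ :=
  fun x y => ∏ l, A l (fun k => x k l) (fun k => y k l)

lemma copiesOp_eq_submatrix (A : Fin L → Matrix (∀ k, ι k) (∀ k, ι k) ℂ) :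
    copiesOp A = (tensorOp A).submatrix (Equiv.piComm fun (k : Fin m) (_ : Fin L) => ι k)
      (Equiv.piComm fun (k : Fin m) (_ : Fin L) => ι k) := rfl

lemma Ensemble.foldState_eq_copiesOp (E : Ensemble n (∀ k, ι k)) (c : Fin L → Fin n) :
    E.foldState c = copiesOp fun l => E.state (c l) := rfl

lemma copiesOp_posSemidef [∀ k, Fintype (ι k)] {A : Fin L → Matrix (∀ k, ι k) (∀ k, ι k) ℂ}
    (hA : ∀ l, (A l).PosSemidef) : (copiesOp A).PosSemidef :=
  (tensorOp_posSemidef hA).submatrix _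

lemma trace_copiesOp [∀ k, Fintype (ι k)] (A : Fin L → Matrix (∀ k, ι k) (∀ k, ι k) ℂ) :
    (copiesOp A).trace = ∏ l, (A l).trace := by
  rw [← trace_tensorOp, copiesOp_eq_submatrix]
  exact Equiv.sum_comp (Equiv.piComm fun (k : Fin m) (_ : Fin L) => ι k)
    fun z => tensorOp A z z

lemma copiesOp_mul [∀ k, Fintype (ι k)] (A B : Fin L → Matrix (∀ k, ι k) (∀ k, ι k) ℂ) :
    copiesOp A * copiesOp B = copiesOp fun l => A l * B l := by
  simp only [copiesOp_eq_submatrix, Matrix.submatrix_mul_equiv, tensorOp_mul]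

lemma copiesOp_one [∀ k, DecidableEq (ι k)] :
    copiesOp (fun _ : Fin L => (1 : Matrix (∀ k, ι k) (∀ k, ι k) ℂ)) = 1 := by
  rw [copiesOp_eq_submatrix, tensorOp_one, Matrix.submatrix_one_equiv]

lemma copiesOp_sum {J : Type} [Fintype J]
    (A : J → Matrix (∀ k, ι k) (∀ k, ι k) ℂ) :
    copiesOp (fun _ : Fin L => ∑ j, A j) = ∑ c : Fin L → J, copiesOp fun l => A (c l) := by
  ext x y
  simp only [copiesOp, Matrix.sum_apply, Finset.prod_univ_sum, Fintype.piFinset_univ]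

lemma copiesOp_smul (t : Fin L → ℂ) (A : Fin L → Matrix (∀ k, ι k) (∀ k, ι k) ℂ) :
    copiesOp (fun l => t l • A l) = (∏ l, t l) • copiesOp A := by
  ext x y
  simp [copiesOp, Finset.prod_mul_distrib]

/-- The operator `∑ c, ⨂ l, A (c l)`, over the words `c` with sum `i` modulo `n`. -/
def convOp [NeZero n] (L : ℕ) (A : Fin n → Matrix (∀ k, ι k) (∀ k, ι k) ℂ) (i : Fin n) :
    Matrix (∀ k, Fin L → ι k) (∀ k, Fin L → ι k) ℂ :=
  ∑ c : Fin L → Fin n with modSum c = i, copiesOp fun l => A (c l)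

lemma sum_convOp [NeZero n] (A : Fin n → Matrix (∀ k, ι k) (∀ k, ι k) ℂ) :
    ∑ i, convOp L A i = copiesOp fun _ => ∑ i, A i := by
  rw [copiesOp_sum]
  exact Finset.sum_fiberwise _ _ _

lemma convOp_posSemidef [NeZero n] [∀ k, Fintype (ι k)]
    {A : Fin n → Matrix (∀ k, ι k) (∀ k, ι k) ℂ} (hA : ∀ i, (A i).PosSemidef) (i : Fin n) :
    (convOp L A i).PosSemidef :=
  Matrix.posSemidef_sum _ fun _ _ => copiesOp_posSemidef fun _ => hA _

lemma convOp_le_copiesOp [NeZero n] [∀ k, Fintype (ι k)]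
    {A : Fin n → Matrix (∀ k, ι k) (∀ k, ι k) ℂ} (hA : ∀ i, (A i).PosSemidef) (i : Fin n) :
    (copiesOp (fun _ => ∑ i, A i) - convOp L A i).PosSemidef := by
  rw [← sum_convOp, ← Finset.sum_erase_eq_sub (Finset.mem_univ i)]
  exact Matrix.posSemidef_sum _ fun j _ => convOp_posSemidef hA j

end copies

/-! ### Convolution powers modulo `n` -/

section convolution

variable {n : ℕ} [NeZero n]

lemma modSum_eq_sum {L : ℕ} (c : Fin L → Fin n) : modSum c = ∑ l, c l := by
  induction L with
  | zero => simp [modSum]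
  | succ L ih =>
    have h : modSum c = c 0 + modSum (fun l : Fin L => c l.succ) := by
      simp only [modSum, Fin.sum_univ_succ]
      apply Fin.ext
      simp [Fin.val_add, Fin.ofNat]
    rw [h, ih, Fin.sum_univ_succ]

/-- The sum of `∏ l, f l (c l)` over the words `c` with sum `i` modulo `n`. -/
def convProd {L : ℕ} (f : Fin L → Fin n → ℂ) (i : Fin n) : ℂ :=
  ∑ c : Fin L → Fin n with modSum c = i, ∏ l, f l (c l)

lemma sum_convProd {L : ℕ} (f : Fin L → Fin n → ℂ) :
    ∑ i, convProd f i = ∏ l, ∑ i, f l i := by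
  rw [Finset.prod_univ_sum, Fintype.piFinset_univ]
  exact Finset.sum_fiberwise _ _ _

lemma convProd_succ {L : ℕ} (f : Fin (L + 1) → Fin n → ℂ) (i : Fin n) :
    convProd f i = ∑ a, f 0 a * convProd (fun l : Fin L => f l.succ) (i - a) := by
  simp only [convProd, Finset.sum_filter, Finset.mul_sum]
  rw [← (Fin.consEquiv fun _ : Fin (L + 1) => Fin n).sum_comp, Fintype.sum_prod_type]
  refine Finset.sum_congr rfl fun a _ => Finset.sum_congr rfl fun c _ => ?_
  simp only [modSum_eq_sum, Fin.consEquiv_apply, Fin.sum_univ_succ, Fin.prod_univ_succ,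
    Fin.cons_zero, Fin.cons_succ, mul_ite, mul_zero, eq_sub_iff_add_eq']

/-- If `s l i + e l i = h l` for all `i`, the `n`-periodic convolutions of the `s l` and of the
`e l` differ from their means by the same quantity up to sign. -/
lemma convProd_eq_of_add_eq {L : ℕ} {s e : Fin L → Fin n → ℂ} {h : Fin L → ℂ}
    (hse : ∀ l i, s l i + e l i = h l) (i : Fin n) :
    convProd s i = (n : ℂ)⁻¹ * ∏ l, ∑ j, s l j +
      (-1) ^ L * (convProd e i - (n : ℂ)⁻¹ * ∏ l, ∑ j, e l j) := by
  induction L generalizing i with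
  | zero => simp [convProd]
  | succ L ih =>
    have hn : (n : ℂ) ≠ 0 := Nat.cast_ne_zero.mpr (NeZero.ne n)
    have ih' := ih (s := fun l => s l.succ) (e := fun l => e l.succ) (h := fun l => h l.succ)
      fun l i => hse l.succ i
    rw [convProd_succ, convProd_succ e, Fin.prod_univ_succ, Fin.prod_univ_succ]
    simp only [ih']
    set S := ∏ l : Fin L, ∑ j, s l.succ j
    set T := ∏ l : Fin L, ∑ j, e l.succ j with hT
    set G := convProd fun l : Fin L => e l.succ with hG
    have hG_sum : ∑ a, G (i - a) = T := by
      rw [hT, ← sum_convProd]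
      exact (Equiv.subLeft i).sum_comp G
    have hs : ∀ a, s 0 a = h 0 - e 0 a := fun a => eq_sub_of_add_eq (hse 0 a)
    have hS0 : ∑ a, s 0 a = n * h 0 - ∑ a, e 0 a := by
      simp [hs, Finset.sum_sub_distrib]
    -- The constant `h 0` only sees the total `T` of `G`, so replacing `s 0` by `-e 0` costs a term
    -- independent of `i`. This is the source of one factor `-1` per copy.
    have key : ∑ a, s 0 a * G (i - a) = h 0 * T - ∑ a, e 0 a * G (i - a) := by
      simp only [hs, sub_mul, Finset.sum_sub_distrib, ← Finset.mul_sum, hG_sum]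
    calc ∑ a, s 0 a * ((n : ℂ)⁻¹ * S + (-1) ^ L * (G (i - a) - (n : ℂ)⁻¹ * T))
        = (∑ a, s 0 a) * ((n : ℂ)⁻¹ * S - (-1) ^ L * (n : ℂ)⁻¹ * T)
          + (-1) ^ L * ∑ a, s 0 a * G (i - a) := by
          rw [Finset.sum_mul, Finset.mul_sum, ← Finset.sum_add_distrib]
          exact Finset.sum_congr rfl fun a _ => by ring
      _ = _ := by
          rw [key, pow_succ]
          have h0 : h 0 = (n : ℂ)⁻¹ * (∑ a, s 0 a + ∑ a, e 0 a) := by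
            rw [hS0]; field_simp; ring
          rw [h0]; ring

/-- Entrywise this is the scalar identity. An entry of a tensor product multiplies entries taken at
a different position in each copy, which is why the scalar version allows `L` different functions.
-/
lemma convOp_eq_of_add_eq {m L : ℕ} {ι : Fin m → Type}
    {A B : Fin n → Matrix (∀ k, ι k) (∀ k, ι k) ℂ} {H : Matrix (∀ k, ι k) (∀ k, ι k) ℂ}
    (hAB : ∀ i, A i + B i = H) (i : Fin n) :
    convOp L A i = (n : ℂ)⁻¹ • copiesOp (fun _ => ∑ j, A j) +
      (-1) ^ L • (convOp L B i - (n : ℂ)⁻¹ • copiesOp (fun _ => ∑ j, B j)) := by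
  ext x y
  have h := convProd_eq_of_add_eq (L := L)
    (s := fun l i => A i (fun k => x k l) (fun k => y k l))
    (e := fun l i => B i (fun k => x k l) (fun k => y k l))
    (h := fun l => H (fun k => x k l) (fun k => y k l))
    (fun l i => by rw [← hAB i]; rfl) i
  simpa [convOp, copiesOp, convProd, Matrix.sum_apply, zsmul_eq_mul] using h

/-- The convolution powers of operators below `H` are bounded by a single operator. -/
lemma convOp_le {m L : ℕ} {ι : Fin m → Type} [∀ k, Fintype (ι k)] (hn : 2 ≤ n)
    {A : Fin n → Matrix (∀ k, ι k) (∀ k, ι k) ℂ} {H : Matrix (∀ k, ι k) (∀ k, ι k) ℂ}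
    (hA : ∀ i, (H - A i).PosSemidef) (i : Fin n) :
    ((((n : ℝ)⁻¹ : ℝ) : ℂ) • copiesOp (fun _ => ∑ j, A j) +
      ((1 - (n : ℝ)⁻¹ : ℝ) : ℂ) • copiesOp (fun _ => ∑ j, (H - A j)) -
        convOp L A i).PosSemidef := by
  have hn' : (2 : ℝ) ≤ n := by exact_mod_cast hn
  have hinv : (n : ℝ)⁻¹ ≤ 2⁻¹ := inv_anti₀ two_pos hn'
  rw [convOp_eq_of_add_eq (B := fun j => H - A j) (H := H) (fun j => by abel) i]
  set S := copiesOp (L := L) fun _ => ∑ j, A j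
  set T := copiesOp (L := L) fun _ => ∑ j, (H - A j) with hT
  set C := convOp L (fun j => H - A j) i with hC
  have hT_psd : T.PosSemidef :=
    copiesOp_posSemidef fun _ => Matrix.posSemidef_sum _ fun j _ => hA j
  -- The gap is `T - C` for even `L` and `C + (1 - 2/n) T` for odd `L`; the latter is where `2 ≤ n`
  -- enters.
  rcases Nat.even_or_odd L with hL | hL
  · have : (((n : ℝ)⁻¹ : ℝ) : ℂ) • S + ((1 - (n : ℝ)⁻¹ : ℝ) : ℂ) • T -
        ((n : ℂ)⁻¹ • S + (-1) ^ L • (C - (n : ℂ)⁻¹ • T)) = T - C := by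
      rw [hL.neg_one_pow]; push_cast; module
    rw [this]
    exact convOp_le_copiesOp hA i
  · have : (((n : ℝ)⁻¹ : ℝ) : ℂ) • S + ((1 - (n : ℝ)⁻¹ : ℝ) : ℂ) • T -
        ((n : ℂ)⁻¹ • S + (-1) ^ L • (C - (n : ℂ)⁻¹ • T)) =
        C + ((1 - 2 * (n : ℝ)⁻¹ : ℝ) : ℂ) • T := by
      rw [hL.neg_one_pow]; push_cast; module
    rw [this]
    exact (convOp_posSemidef hA i).add (posSemidef_ofReal_smul hT_psd (by linarith))

end convolution

/-! ### Optimal measurements and the dual problem -/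

section duality

variable {n : ℕ} {I : Type} [Fintype I]

/-- `∑ i, Tr (σ i * M i)`, for weighted operators `σ i`. -/
def reward (σ M : Fin n → Matrix I I ℂ) : ℝ :=
  ∑ i, (σ i * M i).trace.re

lemma Ensemble.successProb_eq_reward (E : Ensemble n I)
    (M : Fin n → Matrix I I ℂ) :
    E.successProb M = reward (fun i => (E.prob i : ℂ) • E.state i) M := by
  simp [Ensemble.successProb, reward]

lemma isClosed_posSemidef : IsClosed {A : Matrix I I ℂ | A.PosSemidef} := by
  have h : {A : Matrix I I ℂ | A.PosSemidef} =
      {A | Aᴴ = A} ∩ ⋂ x : I → ℂ, {A | 0 ≤ star x ⬝ᵥ A *ᵥ x} := by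
    ext A
    simp [Matrix.posSemidef_iff_dotProduct_mulVec, Matrix.IsHermitian]
  rw [h]
  refine (isClosed_eq (by fun_prop) continuous_id).inter (isClosed_iInter fun x => ?_)
  exact isClosed_le continuous_const (by fun_prop)

/-- Diagonal entries are nonnegative and sum to `1` over the outcomes; the Gram form `Bᴴ * B` then
controls the off-diagonal ones. -/
lemma IsMeasurement.norm_apply_le [DecidableEq I] {M : Fin n → Matrix I I ℂ} (hM : IsMeasurement M)
    (i : Fin n) (x y : I) : ‖M i x y‖ ≤ 1 := by
  have hdiag : ∀ z, (M i z z).re ≤ 1 := fun z => by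
    have h : ∑ j, (M j z z).re = 1 := by
      have := congrArg (fun A : Matrix I I ℂ => (A z z).re) hM.2
      simpa [Matrix.sum_apply] using this
    rw [← h]
    exact Finset.single_le_sum (f := fun j => (M j z z).re)
      (fun j _ => (Complex.nonneg_iff.mp (hM.1 j).diag_nonneg).1) (Finset.mem_univ i)
  obtain ⟨B, hB⟩ := exists_eq_conjTranspose_mul_self (hM.1 i)
  have hsq : ∀ z, ∑ k, ‖B k z‖ ^ 2 = (M i z z).re := fun z => by
    simp [hB, Matrix.mul_apply, Complex.sq_norm, Complex.normSq_apply]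
  calc ‖M i x y‖ ≤ ∑ k, ‖B k x‖ * ‖B k y‖ := by
        rw [hB, Matrix.mul_apply]
        refine (norm_sum_le _ _).trans_eq ?_
        simp
    _ ≤ ∑ k, (‖B k x‖ ^ 2 + ‖B k y‖ ^ 2) / 2 :=
        Finset.sum_le_sum fun k _ => by nlinarith [sq_nonneg (‖B k x‖ - ‖B k y‖)]
    _ = ((M i x x).re + (M i y y).re) / 2 := by
        rw [← Finset.sum_div, Finset.sum_add_distrib, hsq, hsq]
    _ ≤ 1 := by linarith [hdiag x, hdiag y]

/-- Compactness makes the optimum attained, and the first-order argument for strong duality starts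
from an actual maximizer. -/
lemma isCompact_globalMeasurements [DecidableEq I] : IsCompact (globalMeasurements n I) := by
  have hbox : IsCompact {M : Fin n → Matrix I I ℂ | ∀ i x y, M i x y ∈ Metric.closedBall 0 1} := by
    have := isCompact_univ_pi fun _ : Fin n => isCompact_univ_pi fun _ : I =>
      isCompact_univ_pi fun _ : I => isCompact_closedBall (0 : ℂ) 1
    refine (congrArg IsCompact (Set.ext fun M => ?_)).mp this
    exact ⟨fun h i x y => h i trivial x trivial y trivial, fun h i _ x _ y _ => h i x y⟩
  refine hbox.of_isClosed_subset ?_ fun M hM i x y => by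
    simpa using IsMeasurement.norm_apply_le hM i x y
  have h : globalMeasurements n I =
      (⋂ i, {M | (M i).PosSemidef}) ∩ {M | ∑ i, M i = 1} := by
    ext M
    simp [globalMeasurements, IsMeasurement]
  rw [h]
  refine (isClosed_iInter fun i => ?_).inter (isClosed_eq (by fun_prop) continuous_const)
  exact isClosed_posSemidef.preimage (continuous_apply (A := fun _ : Fin n => Matrix I I ℂ) i)

lemma continuous_reward (σ : Fin n → Matrix I I ℂ) : Continuous (reward σ) := by
  unfold reward
  fun_prop

/-- The measurement that ignores the state and announces `g`. -/
lemma isMeasurement_const [DecidableEq I] (g : Fin n) :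
    IsMeasurement fun i => if i = g then (1 : Matrix I I ℂ) else 0 := by
  refine ⟨fun i => ?_, by simp⟩
  dsimp only
  split_ifs
  exacts [Matrix.PosSemidef.one, Matrix.PosSemidef.zero]

lemma bddAbove_reward [DecidableEq I] (σ : Fin n → Matrix I I ℂ) :
    BddAbove (reward σ '' globalMeasurements n I) :=
  isCompact_globalMeasurements.bddAbove_image (continuous_reward σ).continuousOn

lemma exists_isMaxOn_reward [DecidableEq I] [NeZero n] (σ : Fin n → Matrix I I ℂ) :
    ∃ M ∈ globalMeasurements n I, sSup (reward σ '' globalMeasurements n I) = reward σ M ∧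
      ∀ M' ∈ globalMeasurements n I, reward σ M' ≤ reward σ M := by
  obtain ⟨M, hM, h⟩ := isCompact_globalMeasurements.exists_sSup_image_eq_and_ge
    ⟨_, isMeasurement_const (0 : Fin n)⟩ (continuous_reward σ).continuousOn
  exact ⟨M, hM, h⟩

lemma trace_vecMulVec_star_mul (v : I → ℂ) (A : Matrix I I ℂ) :
    (Matrix.vecMulVec v (star v) * A).trace = star v ⬝ᵥ A *ᵥ v := by
  rw [Matrix.vecMulVec_mul, Matrix.trace_vecMulVec, dotProduct_comm, Matrix.dotProduct_mulVec]

/-- `½ ∑ i, (M i * σ i + σ i * M i)`. -/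
def dualOp (σ M : Fin n → Matrix I I ℂ) : Matrix I I ℂ :=
  (2⁻¹ : ℂ) • ∑ i, (M i * σ i + σ i * M i)

lemma dualOp_isHermitian {σ M : Fin n → Matrix I I ℂ} (hσ : ∀ i, (σ i).IsHermitian)
    (hM : ∀ i, (M i).IsHermitian) : (dualOp σ M).IsHermitian := by
  unfold dualOp Matrix.IsHermitian
  simp only [Matrix.conjTranspose_smul, Matrix.conjTranspose_sum, Matrix.conjTranspose_add,
    Matrix.conjTranspose_mul, (hσ _).eq, (hM _).eq]
  simp [add_comm]

lemma trace_dualOp_re (σ M : Fin n → Matrix I I ℂ) :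
    (dualOp σ M).trace.re = reward σ M := by
  have h : (dualOp σ M).trace = ∑ i, (σ i * M i).trace := by
    simp only [dualOp, Matrix.trace_smul, Matrix.trace_sum, Matrix.trace_add,
      Matrix.trace_mul_comm (M _), ← two_mul, ← Finset.mul_sum, smul_eq_mul]
    ring
  simp [h, reward]

/-- The linear term in `ε` explains the symmetrized form of `dualOp`: it is the derivative of the
reward under conjugation of the measurement by `1 - εP`. -/
lemma reward_conj [DecidableEq I] (σ M : Fin n → Matrix I I ℂ) (P : Matrix I I ℂ) (ε : ℝ) :
    reward σ (fun i => (1 - (ε : ℂ) • P) * M i * (1 - (ε : ℂ) • P)) =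
      reward σ M - 2 * ε * (P * dualOp σ M).trace.re +
        ε ^ 2 * ∑ i, (σ i * (P * M i * P)).trace.re := by
  have hterm : ∀ i, (σ i * ((1 - (ε : ℂ) • P) * M i * (1 - (ε : ℂ) • P))).trace =
      (σ i * M i).trace - ε * (P * (M i * σ i + σ i * M i)).trace +
        ε ^ 2 * (σ i * (P * M i * P)).trace := fun i => by
    have e : σ i * ((1 - (ε : ℂ) • P) * M i * (1 - (ε : ℂ) • P)) =
        σ i * M i - (ε : ℂ) • (σ i * (P * M i) + σ i * M i * P) +
          (ε ^ 2 : ℂ) • (σ i * (P * M i * P)) := by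
      simp only [sub_mul, mul_sub, one_mul, mul_one, Matrix.smul_mul, Matrix.mul_smul, smul_add,
        Matrix.mul_assoc]
      module
    rw [e, Matrix.trace_add, Matrix.trace_sub, Matrix.trace_smul, Matrix.trace_smul,
      Matrix.trace_add, Matrix.trace_mul_comm (σ i) (P * M i), Matrix.trace_mul_comm (σ i * M i) P,
      mul_add, Matrix.trace_add, Matrix.mul_assoc, smul_eq_mul, smul_eq_mul]
  have hP : 2 * (P * dualOp σ M).trace.re = ∑ i, (P * (M i * σ i + σ i * M i)).trace.re := by
    rw [dualOp, Matrix.mul_smul, Matrix.trace_smul, Matrix.mul_sum, Matrix.trace_sum, smul_eq_mul,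
      ← Complex.re_sum]
    simp [Complex.mul_re]
  have hre : ∀ i, (σ i * ((1 - (ε : ℂ) • P) * M i * (1 - (ε : ℂ) • P))).trace.re =
      (σ i * M i).trace.re - ε * (P * (M i * σ i + σ i * M i)).trace.re +
        ε ^ 2 * (σ i * (P * M i * P)).trace.re := fun i => by
    rw [hterm, Complex.add_re, Complex.sub_re, Complex.re_ofReal_mul, ← Complex.ofReal_pow,
      Complex.re_ofReal_mul]
  simp only [reward, hre, Finset.sum_add_distrib, Finset.sum_sub_distrib, ← Finset.mul_sum]
  rw [← hP]
  ring

/-- First-order optimality: the operator built from an optimal measurement is dual feasible. -/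
lemma dualOp_sub_posSemidef [DecidableEq I] {σ M : Fin n → Matrix I I ℂ}
    (hσ : ∀ i, (σ i).IsHermitian) (hM : IsMeasurement M) (hmax : ∀ M', IsMeasurement M' → reward σ M' ≤ reward σ M)
    (j : Fin n) : (dualOp σ M - σ j).PosSemidef := by
  have hherm : (dualOp σ M - σ j).IsHermitian :=
    (dualOp_isHermitian hσ fun i => (hM.1 i).isHermitian).sub (hσ j)
  refine Matrix.PosSemidef.of_dotProduct_mulVec_nonneg hherm fun v => ?_
  rw [← trace_vecMulVec_star_mul]
  set P := Matrix.vecMulVec v (star v) with hPdef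
  have hP : P.PosSemidef := Matrix.posSemidef_vecMulVec_self_star v
  have him : (P * (dualOp σ M - σ j)).trace.im = 0 := by
    have h : star (P * (dualOp σ M - σ j)).trace = (P * (dualOp σ M - σ j)).trace := by
      rw [← Matrix.trace_conjTranspose, Matrix.conjTranspose_mul, hherm.eq, hP.isHermitian.eq,
        Matrix.trace_mul_comm]
    exact Complex.conj_eq_iff_im.mp h
  refine Complex.nonneg_iff.mpr ⟨?_, him.symm⟩
  -- Here `s = ‖v‖²`, as `v` is not normalized.
  obtain ⟨s, hs0, hs⟩ : ∃ s : ℝ, 0 ≤ s ∧ P * P = (s : ℂ) • P := by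
    have h0 : 0 ≤ star v ⬝ᵥ v := dotProduct_star_self_nonneg v
    refine ⟨(star v ⬝ᵥ v).re, (Complex.nonneg_iff.mp h0).1, ?_⟩
    have h1 : (((star v ⬝ᵥ v).re : ℝ) : ℂ) = star v ⬝ᵥ v :=
      Complex.ext rfl (Complex.nonneg_iff.mp h0).2
    rw [h1, hPdef, Matrix.vecMulVec_mul_vecMulVec, Matrix.vecMulVec_smul]
  set t := (P * (dualOp σ M - σ j)).trace.re with ht
  set c := ∑ i, (σ i * (P * M i * P)).trace.re - s * (P * σ j).trace.re with hc
  -- Perturb the optimum: conjugate every element by `B = 1 - εP` and give the missing part `1 - B²`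
  -- to outcome `j`. The reward changes by `-2εt + ε²c`, which cannot be positive; letting `ε → 0`
  -- then gives `t ≥ 0`.
  have key : ∀ ε : ℝ, 0 < ε → ε * s ≤ 1 → ε * c ≤ 2 * t := by
    intro ε hε hεs
    set B : Matrix I I ℂ := 1 - (ε : ℂ) • P with hB
    have hBh : Bᴴ = B := by
      simp [hB, hP.isHermitian.eq]
    have hBB : B * B = 1 - ((2 * ε - ε ^ 2 * s : ℝ) : ℂ) • P := by
      simp only [hB, sub_mul, mul_sub, one_mul, mul_one, Matrix.smul_mul, Matrix.mul_smul, hs]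
      push_cast
      module
    have hcoef : 0 ≤ 2 * ε - ε ^ 2 * s := by nlinarith
    have hM' : IsMeasurement fun i => B * M i * B +
        if i = j then ((2 * ε - ε ^ 2 * s : ℝ) : ℂ) • P else 0 := by
      refine ⟨fun i => ?_, ?_⟩
      · refine Matrix.PosSemidef.add ?_ ?_
        · have := (hM.1 i).conjTranspose_mul_mul_same B
          rwa [hBh] at this
        · split_ifs
          exacts [posSemidef_ofReal_smul hP hcoef, Matrix.PosSemidef.zero]
      · rw [Finset.sum_add_distrib, ← Finset.sum_mul, ← Finset.mul_sum, hM.2, mul_one, hBB]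
        simp
    have hle := hmax _ hM'
    have hval : reward σ (fun i => B * M i * B +
        if i = j then ((2 * ε - ε ^ 2 * s : ℝ) : ℂ) • P else 0) =
        reward σ (fun i => B * M i * B) + (2 * ε - ε ^ 2 * s) * (P * σ j).trace.re := by
      have : ∀ i, (σ i * (if i = j then ((2 * ε - ε ^ 2 * s : ℝ) : ℂ) • P else 0)).trace.re =
          if i = j then (2 * ε - ε ^ 2 * s) * (P * σ j).trace.re else 0 := fun i => by
        split_ifs with h
        · rw [h, Matrix.mul_smul, Matrix.trace_smul, smul_eq_mul, Complex.re_ofReal_mul,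
            Matrix.trace_mul_comm]
        · simp
      simp only [reward, mul_add, Matrix.trace_add, Complex.add_re, Finset.sum_add_distrib, this]
      simp
    rw [hval, hB, reward_conj] at hle
    have htt : t = (P * dualOp σ M).trace.re - (P * σ j).trace.re := by
      rw [ht, mul_sub, Matrix.trace_sub, Complex.sub_re]
    have h2 : ε * (ε * c) ≤ ε * (2 * t) := by rw [hc, htt]; linarith
    exact le_of_mul_le_mul_left h2 hε
  have hlim : Tendsto (fun ε : ℝ => ε * c) (𝓝[>] 0) (𝓝 0) := by
    have : Tendsto (fun ε : ℝ => ε * c) (𝓝 0) (𝓝 (0 * c)) := tendsto_id.mul_const c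
    rw [zero_mul] at this
    exact this.mono_left nhdsWithin_le_nhds
  have hsmall : ∀ᶠ ε : ℝ in 𝓝[>] 0, ε * s ≤ 1 := by
    have : Tendsto (fun ε : ℝ => ε * s) (𝓝 0) (𝓝 (0 * s)) := tendsto_id.mul_const s
    rw [zero_mul] at this
    exact (this.mono_left nhdsWithin_le_nhds).eventually_le_const one_pos
  have h2t : 0 ≤ 2 * t := le_of_tendsto hlim <| by
    filter_upwards [hsmall, self_mem_nhdsWithin] with ε h1 h2
    exact key ε h2 h1
  linarith

/-- Strong duality for the discrimination of weighted Hermitian operators. -/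
lemma exists_dual_optimal [DecidableEq I] [NeZero n] {σ : Fin n → Matrix I I ℂ}
    (hσ : ∀ i, (σ i).IsHermitian) :
    ∃ H : Matrix I I ℂ, (∀ i, (H - σ i).PosSemidef) ∧
      H.trace = ((sSup (reward σ '' globalMeasurements n I) : ℝ) : ℂ) := by
  obtain ⟨M, hM, hsup, hmax⟩ := exists_isMaxOn_reward σ
  refine ⟨dualOp σ M, dualOp_sub_posSemidef hσ hM hmax, ?_⟩
  rw [hsup, ← trace_dualOp_re]
  refine (Complex.conj_eq_iff_re.mp ?_).symm
  rw [starRingEnd_apply, ← Matrix.trace_conjTranspose,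
    (dualOp_isHermitian hσ fun i => (hM.1 i).isHermitian).eq]

end duality

/-! ### Partial transposition and LOCC measurements -/

section partyTranspose

variable {P : Type} [DecidableEq P] {κ κ' : P → Type}

/-- Transposition of the systems of the parties in `S`. -/
def partyTranspose (S : Finset P) (N : Matrix (∀ p, κ p) (∀ p, κ p) ℂ) :
    Matrix (∀ p, κ p) (∀ p, κ p) ℂ :=
  fun x y => N (S.piecewise y x) (S.piecewise x y)

lemma partialTranspose_eq_partyTranspose {m : ℕ} {ι : Fin m → Type} (S : Finset (Fin m))
    (ρ : Matrix (∀ k, ι k) (∀ k, ι k) ℂ) : partialTranspose S ρ = partyTranspose S ρ := rfl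

/-- The exchange of the row and column indices of the parties in `S`. -/
def exchange (κ : P → Type) (S : Finset P) :
    ((∀ p, κ p) × (∀ p, κ p)) ≃ ((∀ p, κ p) × (∀ p, κ p)) :=
  Function.Involutive.toPerm (fun z => (S.piecewise z.2 z.1, S.piecewise z.1 z.2)) fun z => by
    refine Prod.ext (funext fun p => ?_) (funext fun p => ?_) <;>
      by_cases hp : p ∈ S <;> simp [hp]

lemma partyTranspose_sum {J : Type} (s : Finset J) (S : Finset P)
    (N : J → Matrix (∀ p, κ p) (∀ p, κ p) ℂ) :
    partyTranspose S (∑ j ∈ s, N j) = ∑ j ∈ s, partyTranspose S (N j) := by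
  ext x y
  simp [partyTranspose, Matrix.sum_apply]

lemma partyTranspose_one [Fintype P] [∀ p, DecidableEq (κ p)] (S : Finset P) :
    partyTranspose S (1 : Matrix (∀ p, κ p) (∀ p, κ p) ℂ) = 1 := by
  ext x y
  have h : S.piecewise y x = S.piecewise x y ↔ x = y := by
    refine ⟨fun h => funext fun p => ?_, fun h => by rw [h]⟩
    have := congrFun h p
    by_cases hp : p ∈ S <;> simp_all
  simp only [partyTranspose, Matrix.one_apply, h]

lemma partyTranspose_empty (N : Matrix (∀ p, κ p) (∀ p, κ p) ℂ) :
    partyTranspose ∅ N = N := by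
  ext x y
  simp [partyTranspose]

lemma partyTranspose_isHermitian (S : Finset P) {N : Matrix (∀ p, κ p) (∀ p, κ p) ℂ}
    (hN : N.IsHermitian) : (partyTranspose S N).IsHermitian := by
  ext x y
  exact hN.apply _ _

lemma trace_partyTranspose [Fintype P] [∀ p, Fintype (κ p)] (S : Finset P)
    (N : Matrix (∀ p, κ p) (∀ p, κ p) ℂ) : (partyTranspose S N).trace = N.trace := by
  simp [Matrix.trace, partyTranspose, Finset.piecewise_same]

lemma trace_mul_eq_sum_prod {J : Type} [Fintype J] (A B : Matrix J J ℂ) :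
    (A * B).trace = ∑ z : J × J, A z.1 z.2 * B z.2 z.1 := by
  simp [Matrix.trace, Matrix.mul_apply, Fintype.sum_prod_type]

/-- Partial transposition only permutes the pairs (row, column), and it permutes the terms of the
trace pairing accordingly. -/
lemma trace_partyTranspose_mul [Fintype P] [∀ p, Fintype (κ p)] (S : Finset P)
    (A B : Matrix (∀ p, κ p) (∀ p, κ p) ℂ) :
    (partyTranspose S A * partyTranspose S B).trace = (A * B).trace := by
  rw [trace_mul_eq_sum_prod, trace_mul_eq_sum_prod]
  exact (exchange κ S).sum_comp fun z => A z.1 z.2 * B z.2 z.1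

lemma conj_mul_apply {J K : Type} [Fintype J] (A : Matrix J K ℂ) (N : Matrix J J ℂ) (x y : K) :
    (Aᴴ * N * A) x y = ∑ z : J × J, star (A z.1 x) * A z.2 y * N z.1 z.2 := by
  simp only [Matrix.mul_apply, Matrix.conjTranspose_apply, Finset.sum_mul, Fintype.sum_prod_type]
  rw [Finset.sum_comm]
  exact Finset.sum_congr rfl fun _ _ => Finset.sum_congr rfl fun _ _ => by ring

/-- The local form of `(Kᴴ N K)ᵀ = (K̄)ᴴ Nᵀ K̄`: a conjugation by a product operator stays a
conjugation after transposing some of the parties. -/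
lemma partyTranspose_conj_tensorOp [Fintype P] [∀ p, Fintype (κ' p)] (S : Finset P)
    (K : ∀ p, Matrix (κ' p) (κ p) ℂ) (N : Matrix (∀ p, κ' p) (∀ p, κ' p) ℂ) :
    partyTranspose S ((tensorOp K)ᴴ * N * tensorOp K) =
      (tensorOp fun p => if p ∈ S then (K p).map star else K p)ᴴ * partyTranspose S N *
        tensorOp fun p => if p ∈ S then (K p).map star else K p := by
  ext x y
  rw [conj_mul_apply, partyTranspose, conj_mul_apply, ← (exchange κ' S).sum_comp]
  refine Finset.sum_congr rfl fun z _ => ?_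
  congr 1
  change star (∏ p, K p (S.piecewise z.2 z.1 p) (S.piecewise y x p)) *
    (∏ p, K p (S.piecewise z.1 z.2 p) (S.piecewise x y p)) = _
  simp only [tensorOp, star_prod, ← Finset.prod_mul_distrib]
  refine Finset.prod_congr rfl fun p _ => ?_
  by_cases hp : p ∈ S
  · simp [hp, mul_comm]
  · simp [hp]

end partyTranspose

/-! ### LOCC measurements: positive partial transposes, normalization and relabelling -/

section locc

variable {n : ℕ}

/-- Induction on the rounds: the final guesses `1` and `0` are unchanged by transposition, and each
round only sums conjugations by product operators. The case `S = ∅` is ordinary positivity. -/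
lemma IsLOCCRounds.posSemidef_partyTranspose {P : Type} [Fintype P] [DecidableEq P] {r : ℕ}
    {κ : P → Type} [∀ p, Fintype (κ p)] [∀ p, DecidableEq (κ p)]
    {M : Fin n → Matrix (∀ p, κ p) (∀ p, κ p) ℂ} (hM : IsLOCCRounds r κ M) (S : Finset P)
    (i : Fin n) : (partyTranspose S (M i)).PosSemidef := by
  induction r generalizing κ with
  | zero =>
    obtain ⟨g, hg⟩ := hM
    rw [hg]
    split_ifs
    · rw [partyTranspose_one]
      exact Matrix.PosSemidef.one
    · exact Matrix.PosSemidef.zero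
  | succ r ih =>
    obtain ⟨a, d, K, N, -, hN, hMN⟩ := hM
    rw [hMN, partyTranspose_sum]
    refine Matrix.posSemidef_sum _ fun j _ => ?_
    rw [partyTranspose_conj_tensorOp]
    exact (ih (hN j)).conjTranspose_mul_mul_same _

lemma IsLOCCRounds.sum_eq_one {P : Type} [Fintype P] [DecidableEq P] {r : ℕ}
    {κ : P → Type} [∀ p, Fintype (κ p)] [∀ p, DecidableEq (κ p)]
    {M : Fin n → Matrix (∀ p, κ p) (∀ p, κ p) ℂ} (hM : IsLOCCRounds r κ M) :
    ∑ i, M i = 1 := by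
  induction r generalizing κ with
  | zero =>
    obtain ⟨g, hg⟩ := hM
    simp [hg]
  | succ r ih =>
    obtain ⟨a, d, K, N, hK, hN, hMN⟩ := hM
    simp only [hMN]
    rw [Finset.sum_comm]
    have h : ∀ j : (∀ p, Fin (a p)), ∑ i, (tensorOp fun p => K p (j p))ᴴ * N j i *
        (tensorOp fun p => K p (j p)) = tensorOp fun p => (K p (j p))ᴴ * K p (j p) := fun j => by
      rw [← Matrix.sum_mul, ← Matrix.mul_sum, ih (hN j), Matrix.mul_one, tensorOp_conjTranspose,
        tensorOp_mul]
    rw [Finset.sum_congr rfl fun j _ => h j, ← tensorOp_sum fun p j => (K p j)ᴴ * K p j]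
    simp only [hK]
    exact tensorOp_one

lemma IsLOCCRounds.relabel {P : Type} [Fintype P] [DecidableEq P] {r : ℕ}
    {κ : P → Type} [∀ p, Fintype (κ p)] [∀ p, DecidableEq (κ p)]
    {M : Fin n → Matrix (∀ p, κ p) (∀ p, κ p) ℂ} (hM : IsLOCCRounds r κ M)
    (e : Equiv.Perm (Fin n)) : IsLOCCRounds r κ fun i => M (e i) := by
  induction r generalizing κ with
  | zero =>
    obtain ⟨g, hg⟩ := hM
    refine ⟨e.symm g, fun i => ?_⟩
    simp only [hg, Equiv.eq_symm_apply]
  | succ r ih =>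
    obtain ⟨a, d, K, N, hK, hN, hMN⟩ := hM
    exact ⟨a, d, K, fun j i => N j (e i), hK, fun j => ih (hN j), fun i => hMN (e i)⟩


lemma regroup_injective {m : ℕ} {ι : Fin m → Type}
    (X : Finpartition (Finset.univ : Finset (Fin m))) :
    Function.Injective (regroup (ι := ι) X) := fun _ _ h => funext fun k =>
  congrFun (congrFun h ⟨X.part k, X.part_mem.mpr (Finset.mem_univ k)⟩)
    ⟨k, X.mem_part (Finset.mem_univ k)⟩

variable {m : ℕ} {ι : Fin m → Type} [∀ k, Fintype (ι k)] [∀ k, DecidableEq (ι k)]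
  {X : Finpartition (Finset.univ : Finset (Fin m))}

lemma sum_loccMeasurement {M : Fin n → Matrix (∀ k, ι k) (∀ k, ι k) ℂ}
    (hM : M ∈ loccMeasurements n ι X) : ∑ i, M i = 1 := by
  obtain ⟨r, N, hN, hMN⟩ := hM
  have h : ∑ i, M i = (∑ i, N i).submatrix (regroup X) (regroup X) := by
    ext x y
    simp [hMN, Matrix.sum_apply]
  rw [h, hN.sum_eq_one, Matrix.submatrix_one _ (regroup_injective X)]

lemma posSemidef_loccMeasurement {M : Fin n → Matrix (∀ k, ι k) (∀ k, ι k) ℂ}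
    (hM : M ∈ loccMeasurements n ι X) (i : Fin n) : (M i).PosSemidef := by
  obtain ⟨r, N, hN, hMN⟩ := hM
  rw [hMN, ← partyTranspose_empty (N i)]
  exact (hN.posSemidef_partyTranspose ∅ i).submatrix _

lemma loccMeasurements_subset_globalMeasurements :
    loccMeasurements n ι X ⊆ globalMeasurements n (∀ k, ι k) := fun _ hM =>
  ⟨posSemidef_loccMeasurement hM, sum_loccMeasurement hM⟩

/-- LOCC measurements have positive partial transpose with respect to each block. -/
lemma posSemidef_partialTranspose_loccMeasurement
    {M : Fin n → Matrix (∀ k, ι k) (∀ k, ι k) ℂ} (hM : M ∈ loccMeasurements n ι X)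
    {A : Finset (Fin m)} (hA : A ∈ X.parts) (i : Fin n) :
    (partialTranspose Aᶜ (M i)).PosSemidef := by
  obtain ⟨r, N, hN, hMN⟩ := hM
  -- Because `A` is a whole block, exchanging the players outside `A` is the same as exchanging all
  -- the other blocks.
  have hpw : ∀ x y : ∀ k, ι k, regroup X ((Aᶜ).piecewise x y) =
      (({⟨A, hA⟩}ᶜ : Finset {A // A ∈ X.parts})).piecewise (regroup X x) (regroup X y) := by
    intro x y
    funext B k
    have hk : k.1 ∈ A ↔ B = ⟨A, hA⟩ := by
      rw [Subtype.ext_iff]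
      exact ⟨fun h => X.eq_of_mem_parts B.2 hA k.2 h, fun h => (Finset.ext_iff.mp h k.1).mp k.2⟩
    by_cases hB : B = ⟨A, hA⟩
    · simp [regroup, hk, hB]
    · simp [regroup, Finset.piecewise, hk, hB]
  have h : partialTranspose Aᶜ (M i) =
      (partyTranspose ({⟨A, hA⟩}ᶜ) (N i)).submatrix (regroup X) (regroup X) := by
    ext x y
    simp only [partialTranspose, hMN, Matrix.submatrix_apply, partyTranspose, hpw]
  rw [h]
  exact (hN.posSemidef_partyTranspose _ i).submatrix _

lemma relabel_mem_loccMeasurements {M : Fin n → Matrix (∀ k, ι k) (∀ k, ι k) ℂ}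
    (hM : M ∈ loccMeasurements n ι X) (e : Equiv.Perm (Fin n)) :
    (fun i => M (e i)) ∈ loccMeasurements n ι X := by
  obtain ⟨r, N, hN, hMN⟩ := hM
  exact ⟨r, _, hN.relabel e, fun i => hMN (e i)⟩

lemma const_mem_loccMeasurements (X : Finpartition (Finset.univ : Finset (Fin m))) (g : Fin n) :
    (fun i => if i = g then (1 : Matrix (∀ k, ι k) (∀ k, ι k) ℂ) else 0) ∈
      loccMeasurements n ι X := by
  refine ⟨0, fun i => if i = g then 1 else 0, ⟨g, fun i => rfl⟩, fun i => ?_⟩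
  dsimp only
  split_ifs
  · rw [Matrix.submatrix_one _ (regroup_injective X)]
  · rfl

lemma relabel_mem_globalMeasurements {I : Type} [Fintype I] [DecidableEq I]
    {M : Fin n → Matrix I I ℂ} (hM : M ∈ globalMeasurements n I) (e : Equiv.Perm (Fin n)) :
    (fun i => M (e i)) ∈ globalMeasurements n I :=
  ⟨fun i => hM.1 (e i), (Equiv.sum_comp e M).trans hM.2⟩

end locc

/-! ### Bounds on the reward -/

section reward

variable {n : ℕ} {I : Type} [Fintype I] [DecidableEq I]

/-- Weak duality. -/
lemma reward_le_trace {σ M : Fin n → Matrix I I ℂ} {H : Matrix I I ℂ}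
    (hH : ∀ i, (H - σ i).PosSemidef) (hM : IsMeasurement M) : reward σ M ≤ H.trace.re := by
  have h : H.trace.re = ∑ i, (H * M i).trace.re := by
    rw [← Complex.re_sum, ← Matrix.trace_sum, ← Matrix.mul_sum, hM.2, mul_one]
  rw [h, reward]
  refine Finset.sum_le_sum fun i _ => ?_
  have := (Complex.nonneg_iff.mp (trace_mul_nonneg (hH i) (hM.1 i))).1
  rw [sub_mul, Matrix.trace_sub, Complex.sub_re] at this
  linarith

/-- The traces average to `1/n`, so some constant guess earns that much. No positivity of `σ` is
required, so partial transposes are covered. -/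
lemma one_div_le_sSup_reward [NeZero n] {σ : Fin n → Matrix I I ℂ} (hσ : (∑ i, σ i).trace = 1)
    {C : Set (Fin n → Matrix I I ℂ)} (hC : C ⊆ globalMeasurements n I)
    (hconst : ∀ g, (fun i => if i = g then (1 : Matrix I I ℂ) else 0) ∈ C) :
    1 / (n : ℝ) ≤ sSup (reward σ '' C) := by
  have hn : (n : ℝ) ≠ 0 := Nat.cast_ne_zero.mpr (NeZero.ne n)
  have hsum : ∑ _i : Fin n, 1 / (n : ℝ) ≤ ∑ i, (σ i).trace.re := by
    rw [← Complex.re_sum, ← Matrix.trace_sum, hσ]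
    simp [hn]
  obtain ⟨g, -, hg⟩ := Finset.exists_le_of_sum_le Finset.univ_nonempty hsum
  have hval : reward σ (fun i => if i = g then (1 : Matrix I I ℂ) else 0) = (σ g).trace.re := by
    have : ∀ i, (σ i * if i = g then (1 : Matrix I I ℂ) else 0).trace.re =
        if i = g then (σ g).trace.re else 0 := fun i => by
      split_ifs with h <;> simp [h]
    simp only [reward, this, Finset.sum_ite_eq', Finset.mem_univ, if_true]
  rw [← hval] at hg
  exact hg.trans (le_csSup ((bddAbove_reward σ).mono (Set.image_mono hC)) ⟨_, hconst g, rfl⟩)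

end reward

/-! ### Multi-fold ensembles -/

section multi

variable {n m : ℕ} {ι : Fin m → Type}

/-- The operators `η i • ρ i`. -/
def Ensemble.weighted {I : Type} (E : Ensemble n I) (i : Fin n) : Matrix I I ℂ :=
  (E.prob i : ℂ) • E.state i

lemma Ensemble.optSuccess_eq {I : Type} [Fintype I] (E : Ensemble n I)
    (C : Set (Fin n → Matrix I I ℂ)) : E.optSuccess C = sSup (reward E.weighted '' C) := by
  have h : E.successProb = reward E.weighted := funext E.successProb_eq_reward
  rw [Ensemble.optSuccess, h]

lemma Ensemble.IsStateEnsemble.weighted_posSemidef {I : Type} [Fintype I] {E : Ensemble n I}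
    (hE : E.IsStateEnsemble) (i : Fin n) : (E.weighted i).PosSemidef :=
  posSemidef_ofReal_smul (hE.state_posSemidef i) (hE.prob_nonneg i)

lemma Ensemble.IsStateEnsemble.trace_sum_weighted {I : Type} [Fintype I] {E : Ensemble n I}
    (hE : E.IsStateEnsemble) : (∑ i, E.weighted i).trace = 1 := by
  simp only [Ensemble.weighted, Matrix.trace_sum, Matrix.trace_smul, hE.state_trace, smul_eq_mul,
    mul_one]
  exact_mod_cast hE.prob_sum

lemma Ensemble.convOp_weighted [NeZero n] (E : Ensemble n (∀ k, ι k)) (L : ℕ) (i : Fin n) :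
    convOp L E.weighted i =
      ∑ c : Fin L → Fin n with modSum c = i, (E.foldProb c : ℂ) • E.foldState c := by
  refine Finset.sum_congr rfl fun c _ => ?_
  simp only [Ensemble.weighted, copiesOp_smul, Ensemble.foldProb, Ensemble.foldState_eq_copiesOp,
    Complex.ofReal_prod]

variable [∀ k, Fintype (ι k)]

lemma Ensemble.IsStateEnsemble.weighted_multi [NeZero n] {E : Ensemble n (∀ k, ι k)}
    (hE : E.IsStateEnsemble) (L : ℕ) : (E.multi L).weighted = convOp L E.weighted := by
  funext i
  rw [Ensemble.convOp_weighted, Ensemble.weighted]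
  simp only [Ensemble.multi]
  -- A vanishing sum of nonnegative weights has only zero terms, so the default state at such an
  -- index is harmless.
  by_cases h : ∑ c : Fin L → Fin n with modSum c = i, E.foldProb c = 0
  · have h0 := (Finset.sum_eq_zero_iff_of_nonneg fun c _ =>
      Finset.prod_nonneg fun l _ => hE.prob_nonneg (c l)).mp h
    rw [h, Finset.sum_eq_zero fun c hc => by
      rw [show E.foldProb c = 0 from h0 c hc, Complex.ofReal_zero, zero_smul]]
    simp
  · rw [smul_smul, mul_inv_cancel₀ (Complex.ofReal_ne_zero.mpr h), one_smul]

lemma trace_sum_convOp [NeZero n] {σ : Fin n → Matrix (∀ k, ι k) (∀ k, ι k) ℂ}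
    (hσ : (∑ i, σ i).trace = 1) (L : ℕ) : (∑ i, convOp L σ i).trace = 1 := by
  rw [sum_convOp, trace_copiesOp, hσ]
  simp

lemma reward_partialTranspose (S : Finset (Fin m))
    (σ M : Fin n → Matrix (∀ k, ι k) (∀ k, ι k) ℂ) :
    reward (fun i => partialTranspose S (σ i)) (fun i => partialTranspose S (M i)) =
      reward σ M :=
  Finset.sum_congr rfl fun _ _ => congrArg Complex.re (trace_partyTranspose_mul S _ _)

lemma trace_sum_partialTranspose {σ : Fin n → Matrix (∀ k, ι k) (∀ k, ι k) ℂ}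
    (S : Finset (Fin m)) :
    (∑ i, partialTranspose S (σ i)).trace = (∑ i, σ i).trace := by
  simp only [Matrix.trace_sum, partialTranspose_eq_partyTranspose, trace_partyTranspose]

variable [∀ k, DecidableEq (ι k)]

lemma isMeasurement_convOp [NeZero n] {M : Fin n → Matrix (∀ k, ι k) (∀ k, ι k) ℂ}
    (hM : IsMeasurement M) (L : ℕ) : IsMeasurement (convOp L M) :=
  ⟨convOp_posSemidef hM.1, by rw [sum_convOp, hM.2, copiesOp_one]⟩

/-- The sum of all the weighted states is dual feasible and has trace `1`. -/
lemma reward_convOp_le_one [NeZero n] {E : Ensemble n (∀ k, ι k)} (hE : E.IsStateEnsemble) {L : ℕ}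
    {M : Fin n → Matrix (∀ k, Fin L → ι k) (∀ k, Fin L → ι k) ℂ} (hM : IsMeasurement M) :
    reward (convOp L E.weighted) M ≤ 1 := by
  have h := reward_le_trace (σ := convOp L E.weighted) (H := ∑ i, convOp L E.weighted i)
    (fun i => by rw [sum_convOp]; exact convOp_le_copiesOp hE.weighted_posSemidef i) hM
  rwa [trace_sum_convOp hE.trace_sum_weighted, Complex.one_re] at h

/-- Perfect discrimination of an ensemble is inherited by product measurements. -/
lemma reward_convOp_eq_one [NeZero n] {E : Ensemble n (∀ k, ι k)} (hE : E.IsStateEnsemble)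
    {M : Fin n → Matrix (∀ k, ι k) (∀ k, ι k) ℂ} (hM : IsMeasurement M)
    (h1 : reward E.weighted M = 1) (L : ℕ) :
    reward (convOp L E.weighted) (convOp L M) = 1 := by
  refine le_antisymm (reward_convOp_le_one hE (isMeasurement_convOp hM L)) ?_
  have hnonneg : 0 ≤ ∑ j, (E.weighted j * M j).trace :=
    Finset.sum_nonneg fun j _ => trace_mul_nonneg (hE.weighted_posSemidef j) (hM.1 j)
  have htr : (∑ j, E.weighted j * M j).trace = 1 := by
    rw [Matrix.trace_sum]
    refine Complex.ext ?_ (Complex.nonneg_iff.mp hnonneg).2.symm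
    rw [Complex.re_sum]
    exact h1
  -- The terms in which every copy is identified correctly already add up to `1`; all cross terms
  -- are nonnegative and can be dropped.
  have hdiag : ∑ i, ∑ c : Fin L → Fin n with modSum c = i,
      (copiesOp fun l => E.weighted (c l) * M (c l)).trace.re = 1 := by
    rw [Finset.sum_fiberwise, ← Complex.re_sum, ← Matrix.trace_sum,
      ← copiesOp_sum fun j => E.weighted j * M j, trace_copiesOp, htr]
    simp
  rw [← hdiag, reward]
  refine Finset.sum_le_sum fun i _ => ?_
  rw [convOp, Finset.sum_mul, Matrix.trace_sum, Complex.re_sum]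
  refine Finset.sum_le_sum fun c hc => ?_
  rw [convOp, Finset.mul_sum, Matrix.trace_sum, Complex.re_sum, ← copiesOp_mul]
  exact Finset.single_le_sum (f := fun c' : Fin L → Fin n =>
      (copiesOp (fun l => E.weighted (c l)) * copiesOp fun l => M (c' l)).trace.re)
    (fun c' _ => (Complex.nonneg_iff.mp (trace_mul_nonneg
      (copiesOp_posSemidef fun l => hE.weighted_posSemidef (c l))
      (copiesOp_posSemidef fun l => hM.1 (c' l)))).1) hc

/-! ### Recovering the hidden data -/

lemma Ensemble.recoverProb_eq [NeZero n] (E : Ensemble n (∀ k, ι k)) (L : ℕ)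
    (M : Fin n → Fin n → Matrix (∀ k, Fin L → ι k) (∀ k, Fin L → ι k) ℂ) (x : Fin n) :
    E.recoverProb L M x = ∑ i, (convOp L E.weighted i * M (x + i) x).trace.re := by
  rw [Ensemble.recoverProb, ← Finset.sum_fiberwise Finset.univ modSum]
  refine Finset.sum_congr rfl fun i _ => ?_
  rw [Ensemble.convOp_weighted, Finset.sum_mul, Matrix.trace_sum, Complex.re_sum]
  refine Finset.sum_congr rfl fun c hc => ?_
  rw [(Finset.mem_filter.mp hc).2, Matrix.smul_mul, Matrix.trace_smul, smul_eq_mul,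
    Complex.re_ofReal_mul]

/-- Substituting `z = x + i` regroups the sum by the broadcast value; for each `z`, the guess `x = z
- i` amounts to the guess `i`. -/
lemma Ensemble.sum_recoverProb [NeZero n] (E : Ensemble n (∀ k, ι k)) (L : ℕ)
    (M : Fin n → Fin n → Matrix (∀ k, Fin L → ι k) (∀ k, Fin L → ι k) ℂ) :
    ∑ x, E.recoverProb L M x =
      ∑ z, reward (convOp L E.weighted) fun i => M z (z - i) := by
  simp only [Ensemble.recoverProb_eq, reward]
  rw [Finset.sum_comm]
  conv_rhs => rw [Finset.sum_comm]
  refine Finset.sum_congr rfl fun i _ => ?_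
  rw [← Equiv.sum_comp (Equiv.addRight i) fun z => (convOp L E.weighted i * M z (z - i)).trace.re]
  simp

/-- Guessing the hidden data is as hard as discriminating the multi-fold ensemble. -/
lemma optRecover_eq_optSuccess [NeZero n] {E : Ensemble n (∀ k, ι k)} (hE : E.IsStateEnsemble)
    {L : ℕ} {C : Set (Fin n → Matrix (∀ k, Fin L → ι k) (∀ k, Fin L → ι k) ℂ)}
    (hC : C ⊆ globalMeasurements n (∀ k, Fin L → ι k)) (hne : C.Nonempty)
    (hrel : ∀ M ∈ C, ∀ e : Equiv.Perm (Fin n), (fun i => M (e i)) ∈ C) :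
    E.optRecover L C = (E.multi L).optSuccess C := by
  have hn : (n : ℝ) ≠ 0 := Nat.cast_ne_zero.mpr (NeZero.ne n)
  have hbdd : BddAbove (reward (convOp L E.weighted) '' C) :=
    (bddAbove_reward _).mono (Set.image_mono hC)
  rw [Ensemble.optSuccess_eq, hE.weighted_multi, Ensemble.optRecover]
  -- One discrimination measurement, relabelled by `i ↦ z - i` for each `z`, gives a strategy of
  -- equal average value.
  have hsub : reward (convOp L E.weighted) '' C ⊆
      {p | ∃ M : Fin n → Fin n → Matrix (∀ k, Fin L → ι k) (∀ k, Fin L → ι k) ℂ,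
        (∀ z, M z ∈ C) ∧ p = (1 / (n : ℝ)) * ∑ x, E.recoverProb L M x} := by
    rintro _ ⟨M, hM, rfl⟩
    refine ⟨fun z x => M (z - x), fun z => hrel M hM (Equiv.subLeft z), ?_⟩
    rw [Ensemble.sum_recoverProb]
    simp [hn]
  have hub : ∀ p ∈ {p | ∃ M : Fin n → Fin n → Matrix (∀ k, Fin L → ι k) (∀ k, Fin L → ι k) ℂ,
      (∀ z, M z ∈ C) ∧ p = (1 / (n : ℝ)) * ∑ x, E.recoverProb L M x},
      p ≤ sSup (reward (convOp L E.weighted) '' C) := by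
    rintro _ ⟨M, hM, rfl⟩
    rw [Ensemble.sum_recoverProb]
    calc (1 / (n : ℝ)) * ∑ z, reward (convOp L E.weighted) (fun i => M z (z - i))
        ≤ (1 / (n : ℝ)) * ∑ _z : Fin n, sSup (reward (convOp L E.weighted) '' C) := by
          gcongr with z
          exact le_csSup hbdd ⟨_, hrel _ (hM z) (Equiv.subLeft z), rfl⟩
      _ = _ := by simp [hn]
  exact le_antisymm (csSup_le ((hne.image _).mono hsub) hub)
    (csSup_le_csSup ⟨_, hub⟩ (hne.image _) hsub)

/-! ### The bound on LOCC discrimination -/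

lemma partialTranspose_copiesOp {ι : Fin m → Type} {L : ℕ} (S : Finset (Fin m))
    (A : Fin L → Matrix (∀ k, ι k) (∀ k, ι k) ℂ) :
    partialTranspose S (copiesOp A) = copiesOp fun l => partialTranspose S (A l) := by
  ext x y
  have h : ∀ (u v : ∀ k, Fin L → ι k) (l : Fin L), (fun k => S.piecewise u v k l) =
      S.piecewise (fun k => u k l) fun k => v k l := fun u v l => funext fun k => by
    by_cases hk : k ∈ S <;> simp [hk]
  simp only [partialTranspose, copiesOp, h]

lemma partialTranspose_convOp [NeZero n] {ι : Fin m → Type} {L : ℕ} (S : Finset (Fin m))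
    (A : Fin n → Matrix (∀ k, ι k) (∀ k, ι k) ℂ) (i : Fin n) :
    partialTranspose S (convOp L A i) = convOp L (fun j => partialTranspose S (A j)) i := by
  rw [convOp, partialTranspose_eq_partyTranspose, partyTranspose_sum]
  exact Finset.sum_congr rfl fun c _ => partialTranspose_copiesOp S _

/-- The multi-fold bound in terms of the optimal reward for a single copy. -/
lemma reward_convOp_le [NeZero n] (hn : 2 ≤ n) {σ : Fin n → Matrix (∀ k, ι k) (∀ k, ι k) ℂ}
    (hσ : ∀ i, (σ i).IsHermitian) (htr : (∑ i, σ i).trace = 1) {L : ℕ}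
    {M : Fin n → Matrix (∀ k, Fin L → ι k) (∀ k, Fin L → ι k) ℂ} (hM : IsMeasurement M) :
    reward (convOp L σ) M ≤ 1 / (n : ℝ) +
      (n - 1) / n * (n * sSup (reward σ '' globalMeasurements n (∀ k, ι k)) - 1) ^ L := by
  obtain ⟨H, hH, hHtr⟩ := exists_dual_optimal hσ
  set q := sSup (reward σ '' globalMeasurements n (∀ k, ι k))
  refine (reward_le_trace (convOp_le hn hH) hM).trans_eq ?_
  -- This trace is the base of the exponential rate.
  have hD : (∑ j, (H - σ j)).trace = ((n * q - 1 : ℝ) : ℂ) := by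
    rw [Finset.sum_sub_distrib, Matrix.trace_sub, htr, Matrix.trace_sum]
    simp [hHtr]
  have hn0 : (n : ℝ) ≠ 0 := Nat.cast_ne_zero.mpr (NeZero.ne n)
  simp only [Matrix.trace_add, Matrix.trace_smul, trace_copiesOp, htr, hD, Finset.prod_const,
    Finset.card_univ, Fintype.card_fin, one_pow, smul_eq_mul, ← Complex.ofReal_pow,
    Complex.add_re, Complex.re_ofReal_mul, Complex.ofReal_re, Complex.one_re]
  field_simp

lemma Ensemble.qX_eq [NeZero m] (X : Finpartition (Finset.univ : Finset (Fin m)))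
    (E : Ensemble n (∀ k, ι k)) :
    E.qX X = sSup (reward (fun i => partialTranspose (X.part 0)ᶜ (E.weighted i)) ''
      globalMeasurements n (∀ k, ι k)) :=
  Ensemble.optSuccess_eq _ _

lemma Ensemble.IsStateEnsemble.one_div_le_qX [NeZero m] [NeZero n] {E : Ensemble n (∀ k, ι k)}
    (hE : E.IsStateEnsemble) (X : Finpartition (Finset.univ : Finset (Fin m))) :
    1 / (n : ℝ) ≤ E.qX X := by
  rw [Ensemble.qX_eq]
  exact one_div_le_sSup_reward (by rw [trace_sum_partialTranspose, hE.trace_sum_weighted])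
    subset_rfl isMeasurement_const

lemma Ensemble.qX_le_qMax [NeZero m] (E : Ensemble n (∀ k, ι k))
    {X : Finpartition (Finset.univ : Finset (Fin m))} (hX : X.parts.card = 2) :
    E.qX X ≤ E.qMax :=
  le_ciSup (f := fun X : {X : Finpartition (Finset.univ : Finset (Fin m)) // X.parts.card = 2} =>
    E.qX X.1) (Set.finite_range _).bddAbove ⟨X, hX⟩

/-- A nontrivial partition has a coarsening to a bipartition with the same block of the first
player. -/
lemma exists_bipartition [NeZero m] {X : Finpartition (Finset.univ : Finset (Fin m))}
    (hX : 2 ≤ X.parts.card) : ∃ Y : Finpartition (Finset.univ : Finset (Fin m)),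
      Y.parts.card = 2 ∧ Y.part 0 = X.part 0 := by
  set A := X.part 0 with hA
  have hAX : A ∈ X.parts := X.part_mem.mpr (Finset.mem_univ 0)
  have h0 : (0 : Fin m) ∈ A := X.mem_part (Finset.mem_univ 0)
  have hAc : (Aᶜ).Nonempty := by
    obtain ⟨B, hB, hBA⟩ := Finset.exists_mem_ne (Nat.lt_of_succ_le hX) A
    obtain ⟨b, hb⟩ := X.nonempty_of_mem_parts hB
    exact ⟨b, Finset.mem_compl.mpr fun h => hBA (X.eq_of_mem_parts hB hAX hb h)⟩
  have hne : A ≠ Aᶜ := fun h => Finset.mem_compl.mp (h ▸ h0) h0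
  let Y : Finpartition (Finset.univ : Finset (Fin m)) :=
    { parts := {A, Aᶜ}
      supIndep := (Finset.supIndep_pair hne).mpr disjoint_compl_right
      sup_parts := by simp
      bot_notMem := by
        simp only [Finset.bot_eq_empty, Finset.mem_insert, Finset.mem_singleton, not_or]
        exact ⟨(Finset.nonempty_iff_ne_empty.mp ⟨0, h0⟩).symm,
          (Finset.nonempty_iff_ne_empty.mp hAc).symm⟩ }
  exact ⟨Y, Finset.card_pair hne, Y.part_eq_of_mem (Finset.mem_insert_self _ _) h0⟩

lemma Ensemble.IsStateEnsemble.pX_multi_le [NeZero m] [NeZero n] (hn : 2 ≤ n)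
    {E : Ensemble n (∀ k, ι k)} (hE : E.IsStateEnsemble)
    {X : Finpartition (Finset.univ : Finset (Fin m))} (hX : 2 ≤ X.parts.card) (L : ℕ) :
    (E.multi L).pX X ≤ 1 / (n : ℝ) + (n - 1) / n * (n * E.qMax - 1) ^ L := by
  have hn' : (2 : ℝ) ≤ n := by exact_mod_cast hn
  obtain ⟨Y, hY, hYX⟩ := exists_bipartition hX
  have hq : E.qX Y ≤ E.qMax := E.qX_le_qMax hY
  -- Passing from `qX` to `qMax` inside the `L`-th power needs a nonnegative base.
  have hq0 : 0 ≤ n * E.qX Y - 1 := by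
    have := hE.one_div_le_qX Y
    rw [div_le_iff₀ (by linarith)] at this
    linarith
  rw [Ensemble.pX, Ensemble.optSuccess_eq, hE.weighted_multi]
  refine csSup_le ⟨_, _, const_mem_loccMeasurements X 0, rfl⟩ ?_
  rintro _ ⟨M, hM, rfl⟩
  have hMT : IsMeasurement fun i => partialTranspose (X.part 0)ᶜ (M i) := by
    refine ⟨posSemidef_partialTranspose_loccMeasurement hM
      (X.part_mem.mpr (Finset.mem_univ 0)), ?_⟩
    simp only [partialTranspose_eq_partyTranspose]
    rw [← partyTranspose_sum, sum_loccMeasurement hM, partyTranspose_one]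
  have h := reward_convOp_le hn (σ := fun i => partialTranspose (X.part 0)ᶜ (E.weighted i))
    (fun i => partyTranspose_isHermitian _ (hE.weighted_posSemidef i).isHermitian)
    (by rw [trace_sum_partialTranspose, hE.trace_sum_weighted]) hMT
  -- The transposition depends on a partition only through the block of player `0`, so the bound for
  -- `X` is expressed by `qX` of the bipartition `Y`.
  rw [← hYX, ← Ensemble.qX_eq, hYX] at h
  rw [← reward_partialTranspose (X.part 0)ᶜ]
  simp only [partialTranspose_convOp]
  refine h.trans ?_
  have hc : 0 ≤ ((n : ℝ) - 1) / n := div_nonneg (by linarith) (by linarith)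
  gcongr

lemma Ensemble.IsStateEnsemble.one_div_le_pX_multi [NeZero n] {E : Ensemble n (∀ k, ι k)}
    (hE : E.IsStateEnsemble) (X : Finpartition (Finset.univ : Finset (Fin m))) (L : ℕ) :
    1 / (n : ℝ) ≤ (E.multi L).pX X := by
  rw [Ensemble.pX, Ensemble.optSuccess_eq, hE.weighted_multi]
  exact one_div_le_sSup_reward (trace_sum_convOp hE.trace_sum_weighted L)
    loccMeasurements_subset_globalMeasurements (const_mem_loccMeasurements X)

lemma Ensemble.IsStateEnsemble.one_div_le_qMax [NeZero m] [NeZero n] (hm : 2 ≤ m)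
    {E : Ensemble n (∀ k, ι k)} (hE : E.IsStateEnsemble) : 1 / (n : ℝ) ≤ E.qMax := by
  obtain ⟨Y, hY, -⟩ := exists_bipartition
    (X := (⊥ : Finpartition (Finset.univ : Finset (Fin m)))) (by simpa using hm)
  exact (hE.one_div_le_qX Y).trans (E.qX_le_qMax hY)

end multi

end DataHiding

end

/-! ### The data-hiding theorem -/

open DataHiding in
theorem theorem2 {m n : ℕ} [NeZero m] [NeZero n] (hm : 2 ≤ m) (hn : 2 ≤ n)
    (d : Fin m → ℕ) (hd : ∀ k, 0 < d k)
    (E : Ensemble n (∀ k, Fin (d k))) (hE : E.IsStateEnsemble)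
    (hG : E.pG = 1) (hq : E.qMax < 2 / (n : ℝ)) :
    -- global discrimination of the multi-fold ensemble is perfect
    (∀ L : ℕ, 1 ≤ L → (E.multi L).pG = 1) ∧
    -- non-global discrimination tends to random guessing
    (∀ X : Finpartition (Finset.univ : Finset (Fin m)), 2 ≤ X.parts.card →
      Tendsto (fun L : ℕ => (E.multi L).pX X) atTop (𝓝 (1 / (n : ℝ)))) ∧
    -- with an exponential rate
    (0 ≤ n * E.qMax - 1 ∧ n * E.qMax - 1 < 1 ∧
      ∀ X : Finpartition (Finset.univ : Finset (Fin m)), 2 ≤ X.parts.card →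
        ∀ L : ℕ, 1 ≤ L → 1 / (n : ℝ) ≤ (E.multi L).pX X ∧
          (E.multi L).pX X ≤ 1 / (n : ℝ) + (n - 1) / n * (n * E.qMax - 1) ^ L) ∧
    -- the hidden data are perfectly recovered by suitable global measurements
    (∀ L : ℕ, 1 ≤ L →
      ∃ M : Fin n → Fin n → Matrix (∀ k, Fin L → Fin (d k)) (∀ k, Fin L → Fin (d k)) ℂ,
        (∀ z, M z ∈ globalMeasurements n (∀ k, Fin L → Fin (d k))) ∧
        ∀ x, E.recoverProb L M x = 1) ∧
    -- guessing the hidden data amounts to discriminating the multi-fold ensemble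
    (∀ L : ℕ, 1 ≤ L →
      E.optRecover L (globalMeasurements n (∀ k, Fin L → Fin (d k))) = (E.multi L).pG ∧
      ∀ X : Finpartition (Finset.univ : Finset (Fin m)),
        E.optRecover L (loccMeasurements n (fun k => Fin L → Fin (d k)) X) =
          (E.multi L).pX X) := by
  have hn0 : (0 : ℝ) < n := Nat.cast_pos.mpr (by omega)
  obtain ⟨M, hM, hsup, -⟩ := exists_isMaxOn_reward E.weighted
  have h1 : reward E.weighted M = 1 := by
    rw [← hsup, ← Ensemble.optSuccess_eq]
    exact hG
  have hrate0 : 0 ≤ n * E.qMax - 1 := by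
    have := hE.one_div_le_qMax hm
    rw [div_le_iff₀ hn0] at this
    linarith
  have hrate1 : n * E.qMax - 1 < 1 := by
    rw [lt_div_iff₀ hn0] at hq
    linarith
  refine ⟨fun L _ => ?_, fun X hX => ?_, ⟨hrate0, hrate1, fun X hX L _ =>
    ⟨hE.one_div_le_pX_multi X L, hE.pX_multi_le hn hX L⟩⟩, fun L _ => ?_,
    fun L _ => ⟨?_, fun X => ?_⟩⟩
  · rw [Ensemble.pG, Ensemble.optSuccess_eq, hE.weighted_multi]
    refine IsGreatest.csSup_eq ⟨⟨convOp L M, isMeasurement_convOp hM L,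
      reward_convOp_eq_one hE hM h1 L⟩, ?_⟩
    rintro _ ⟨M', hM', rfl⟩
    exact reward_convOp_le_one hE hM'
  · have hlim : Tendsto (fun L : ℕ => 1 / (n : ℝ) + (n - 1) / n * (n * E.qMax - 1) ^ L) atTop
        (𝓝 (1 / (n : ℝ))) := by
      simpa using ((tendsto_pow_atTop_nhds_zero_of_lt_one hrate0 hrate1).const_mul
        (((n : ℝ) - 1) / n)).const_add (1 / (n : ℝ))
    exact tendsto_of_tendsto_of_tendsto_of_le_of_le tendsto_const_nhds hlim
      (fun L => hE.one_div_le_pX_multi X L) fun L => hE.pX_multi_le hn hX L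
  -- Measure `ω_n(c)` perfectly and subtract it from `z`.
  · refine ⟨fun z x => convOp L M (z - x), fun z =>
      relabel_mem_globalMeasurements (isMeasurement_convOp hM L) (Equiv.subLeft z), fun x => ?_⟩
    rw [Ensemble.recoverProb_eq, ← reward_convOp_eq_one hE hM h1 L, reward]
    simp
  · exact optRecover_eq_optSuccess hE subset_rfl ⟨_, isMeasurement_const 0⟩
      fun M' hM' => relabel_mem_globalMeasurements hM'
  · exact optRecover_eq_optSuccess hE loccMeasurements_subset_globalMeasurements
      ⟨_, const_mem_loccMeasurements X 0⟩ fun M' hM' => relabel_mem_loccMeasurements hM'
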